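/- **Theorem (Correctness of uncertain alignments).** *Nets.* A system net $N=(P,T,F,l,M_{init},M_{final})$ is a Petri net with places $P$, transitions $T$, flow relation $F\subseteq (P\times T)\cup(T\times P)$, a labeling $l\colon T\to A\cup\{\tau\}$ ($\tau$ marks invisible transitions), and an initial and a final marking, which are multisets of places. A transition $t$ is enabled in a marking if each of its input places holds a token; firing it removes one token from each input place and adds one token to each output place. $\phi_f(N)$ is the set of complete firing sequences (leading from $M_{init}$ to $M_{final}$), and $\phi(N)\subseteq A^*$ is the set of their label sequences, with $\tau$ removed. *Alignments.* Let $SN$ be a system net with $\phi(SN)\neq\emptyset$. The legal moves are $(x,(x,t))$ with $l(t)=x\in A$ (synchronous), $(\gg,(l(t),t))$ (on model only) and $(x,\gg)$ with $x\in A$ (on log only). An alignment of $\sigma\in A^*$ is a finite sequence $\gamma$ of legal moves whose first components, ignoring $\gg$, form $\sigma$ and whose transitions form an element of $\phi_f(SN)$. Let $\delta$ be any cost function from the legal moves to $\mathbb{N}$; the cost $\delta(\gamma)$ is the sum of the costs of the moves of $\gamma$. An alignment of $\sigma$ is optimal if its cost is minimal among all alignments of $\sigma$. Let $\lambda_{SN}$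 be any mapping that assigns to each $\sigma\in A^*$ an optimal alignment of $\sigma$. *Uncertain traces.* A simple uncertain trace $\sigma_U$ is a finite set of events $e=(i,\pi_a(e),t_{min}(e),t_{max}(e),\pi_o(e))$ with pairwise distinct identifiers $i$, where $\emptyset\ne\pi_a(e)\subseteq A$, $t_{min}(e)\le t_{max}(e)$ in a totally ordered set of timestamps, and $\pi_o(e)\in\{!,?\}$. Write $e\prec e'$ if $t_{max}(e)<t_{min}(e')$. An order-realization is a permutation of $\sigma_U$ in which no event $e'$ comes before an event $e$ with $e\prec e'$. A realization of $\sigma_U$ is a sequence $\langle a_1,\dots,a_n\rangle$ with $a_i\in\pi_a(e_i)$ for some subsequence $\langle e_1,\dots,e_n\rangle$ of an order-realization that contains every event $e$ with $\pi_o(e)={!}$. $\mathcal R(\sigma_U)$ is the set of realizations, and $$\delta_{min}(\sigma_U)=\min_{\sigma\in\mathcal R(\sigma_U)}\delta(\lambda_{SN}(\sigma)).$$ *Behavior net.* Let $(V,E)$ be the behavior graph of $\sigma_U$, that is, the transitive reduction of the graph with vertex set $V=\sigma_U$ and edge relation $\prec$. The behavior net $bn(\sigma_U)$ has as places the edges in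 $E$, a place $(\mathrm{START},v)$ for each $v\in V$ without predecessor and a place $(v,\mathrm{END})$ for each $v\in V$ without successor. Its transitions are $(v,a)$ for $v\in V$, $a\in\pi_a(v)$, labeled $a$, and $(v,\tau)$ for $v\in V$ with $\pi_o(v)={?}$, invisible. The input places of $(v,a)$ are all places of the form $(\cdot,v)$ and its output places are all places of the form $(v,\cdot)$. Initially there is one token in each place $(\mathrm{START},v)$, finally one in each place $(v,\mathrm{END})$. *Product net.* The product net $SN\otimes bn(\sigma_U)$ has the places of both nets (taken disjoint) and the sums of the initial and of the final markings. Its transitions are $(t_1,\gg)$, $(\gg,t_2)$ and $(t_1,t_2)$ with $l_1(t_1)=l_2(t_2)\neq\tau$, each with the arcs of its components. A firing sequence of the product net represents a sequence of moves: $(t_1,\gg)$ represents $(\gg,(l_1(t_1),t_1))$; $(t_1,t_2)$ represents $(l_1(t_1),(l_1(t_1),t_1))$; $(\gg,t_2)$ represents $(l_2(t_2),\gg)$ if $t_2$ is visible, and no move (at no cost) if $t_2$ is invisible. A complete firing sequence of the product net is optimal if the cost of the moves that it represents is minimal among all complete firing sequences of the product net. *Claim.* The minimum $\delta_{min}(\sigma_U)$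 exists, and the product net $SN\otimes bn(\sigma_U)$ has an optimal complete firing sequence. Moreover, for every optimal complete firing sequence, let $\gamma$ be the sequence of moves that it represents and let $\sigma_{bn}$ be the sequence of first components of $\gamma$, ignoring $\gg$. Then the transitions of $bn(\sigma_U)$ in it form a complete firing sequence of $bn(\sigma_U)$ with label sequence $\sigma_{bn}$; $\sigma_{bn}\in\mathcal R(\sigma_U)$; $\gamma$ is an optimal alignment of $\sigma_{bn}$; and $$\delta(\gamma)=\delta(\lambda_{SN}(\sigma_{bn}))=\min_{\sigma\in\mathcal R(\sigma_U)}\delta(\lambda_{SN}(\sigma))=\delta_{min}(\sigma_U).$$ -/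

import Mathlib

/-! ## Petri nets and system nets -/

/-- A marking: a multiset of places, given by its multiplicity function. -/
abbrev Marking (P : Type*) := P → ℕ

/-- A system net over the activities `A`, with place set `P` and transition set `T`.
The flow relation is split into its part in `P × T` and its part in `T × P`.
The label of a transition is an activity, or `none` (the symbol `τ`) if it is invisible. -/
structure SystemNet (A P T : Type*) where
  flowPT : P → T → Prop
  flowTP : T → P → Prop
  label : T → Option A
  init : Marking P
  final : Marking P

namespace SystemNet

variable {A P T : Type*}

/-- The input places of a transition. -/
def pre (N : SystemNet A P T) (t : T) : Set P := {p | N.flowPT p t}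

/-- The output places of a transition. -/
def post (N : SystemNet A P T) (t : T) : Set P := {p | N.flowTP t p}

/-- Every input place of `t` holds at least one token. -/
def Enabled (N : SystemNet A P T) (M : Marking P) (t : T) : Prop := ∀ p ∈ N.pre t, 1 ≤ M p

/-- `t` is enabled in `M` and firing it results in `M'`: one token is removed from every input
place and one token is added to every output place. -/
def Fires (N : SystemNet A P T) (M : Marking P) (t : T) (M' : Marking P) : Prop :=
  N.Enabled M t ∧ M' = (M - (N.pre t).indicator 1) + (N.post t).indicator 1

/-- Firing a sequence of transitions, one after the other. -/
inductive FiresSeq (N : SystemNet A P T) : Marking P → List T → Marking P → Prop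
  | nil (M : Marking P) : FiresSeq N M [] M
  | cons {M M' M'' : Marking P} {t : T} {s : List T} :
      N.Fires M t M' → FiresSeq N M' s M'' → FiresSeq N M (t :: s) M''

/-- The complete firing sequences: from the initial to the final marking. -/
def completeFirings (N : SystemNet A P T) : Set (List T) := {s | N.FiresSeq N.init s N.final}

/-- The activity sequence of a sequence of transitions; invisible transitions are dropped. -/
def labels (N : SystemNet A P T) (s : List T) : List A := s.filterMap N.label

/-- The visible traces of the net. -/
def visibleTraces (N : SystemNet A P T) : Set (List A) :=
  {σ | ∃ s ∈ N.completeFirings, N.labels s = σ}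

end SystemNet

/-! ## Alignments -/

/-- Pairs `(x, y)`: `x` is an activity or `none` (no move, `≫`); `y` is a pair
(label, transition) of the model, the label being `none` for `τ`, or `y` is `none` (no move, `≫`). -/
abbrev Move (A T : Type*) := Option A × Option (Option A × T)

section Alignments

variable {A P T : Type*}

/-- The legal moves: synchronous moves, moves on model only, moves on log only. -/
def LegalMoves (SN : SystemNet A P T) : Set (Move A T) :=
  {m | ∃ x t, SN.label t = some x ∧ m = (some x, some (some x, t))} ∪
  {m | ∃ t, m = (none, some (SN.label t, t))} ∪
  {m | ∃ x, m = (some x, none)}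

/-- The projection on the log row, ignoring `≫`. -/
def logRow (γ : List (Move A T)) : List A := γ.filterMap fun m => m.1

/-- The projection on the transitions of the model row, ignoring `≫`. -/
def modelRow (γ : List (Move A T)) : List T := γ.filterMap fun m => m.2.map Prod.snd

/-- `γ` is an alignment of the trace `σ` and the firing sequence `s`. -/
def IsAlignment (SN : SystemNet A P T) (σ : List A) (s : List T) (γ : List (Move A T)) : Prop :=
  (∀ m ∈ γ, m ∈ LegalMoves SN) ∧ logRow γ = σ ∧ modelRow γ = s

/-- All alignments of the trace `σ` with complete firing sequences of the system net. -/
def alignments (SN : SystemNet A P T) (σ : List A) : Set (List (Move A T)) :=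
  {γ | ∃ s ∈ SN.completeFirings, IsAlignment SN σ s γ}

/-- The cost of a sequence of moves: the sum of the costs of the moves. -/
def cost (δ : Move A T → ℕ) (γ : List (Move A T)) : ℕ := (γ.map δ).sum

/-- `γ` is an optimal alignment for the trace `σ` and the system net. -/
def IsOptimalAlignment (SN : SystemNet A P T) (δ : Move A T → ℕ) (σ : List A)
    (γ : List (Move A T)) : Prop :=
  γ ∈ alignments SN σ ∧ ∀ γ' ∈ alignments SN σ, cost δ γ ≤ cost δ γ'

/-- A mapping that assigns to every trace an optimal alignment. -/
def IsOptimalAlignmentMap (SN : SystemNet A P T) (δ : Move A T → ℕ)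
    (lam : List A → List (Move A T)) : Prop :=
  ∀ σ, IsOptimalAlignment SN δ σ (lam σ)

/-- Optimal alignments of all traces exist as soon as the system net has a visible trace. -/
theorem exists_isOptimalAlignmentMap (SN : SystemNet A P T) (hSN : SN.visibleTraces.Nonempty)
    (δ : Move A T → ℕ) : ∃ lam, IsOptimalAlignmentMap SN δ lam := by
  obtain ⟨_, s, hs, _⟩ := hSN
  have key : ∀ σ, ∃ γ, IsOptimalAlignment SN δ σ γ := by
    intro σ
    have hne : (alignments SN σ).Nonempty := by
      refine ⟨σ.map (fun x => (some x, none)) ++ s.map (fun t => (none, some (SN.label t, t))),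
        s, hs, ?_, ?_, ?_⟩
      · intro m hm
        rcases List.mem_append.1 hm with h | h
        · obtain ⟨x, _, rfl⟩ := List.mem_map.1 h
          exact Or.inr ⟨x, rfl⟩
        · obtain ⟨t, _, rfl⟩ := List.mem_map.1 h
          exact Or.inl (Or.inr ⟨t, rfl⟩)
      · simp [logRow, List.filterMap_map]
      · simp [modelRow, List.filterMap_map]
    obtain ⟨γ, hγ, hmin⟩ := exists_minimalFor_of_wellFoundedLT (· ∈ alignments SN σ) (cost δ) hne
    refine ⟨γ, hγ, fun γ' hγ' => ?_⟩
    rcases le_total (cost δ γ) (cost δ γ') with h | h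
    · exact h
    · exact hmin hγ' h
  choose lam hlam using key
  exact ⟨lam, hlam⟩

end Alignments

/-! ## The product of two system nets -/

section Product

variable {A P₁ T₁ P₂ T₂ : Type*}

/-- The transitions of the product net: `none` stands for `≫`. -/
def productTransitions (S₁ : SystemNet A P₁ T₁) (S₂ : SystemNet A P₂ T₂) :
    Set (Option T₁ × Option T₂) :=
  {u | ∃ t₁, u = (some t₁, none)} ∪ {u | ∃ t₂, u = (none, some t₂)} ∪
  {u | ∃ t₁ t₂, u = (some t₁, some t₂) ∧ S₁.label t₁ = S₂.label t₂ ∧ S₁.label t₁ ≠ none}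

/-- The product net. Its places are the disjoint union of the places of the two nets; a transition
`(t₁, t₂)` has the arcs of `t₁` (if it is not `≫`) and the arcs of `t₂` (if it is not `≫`). -/
def productNet (S₁ : SystemNet A P₁ T₁) (S₂ : SystemNet A P₂ T₂) :
    SystemNet A (P₁ ⊕ P₂) (productTransitions S₁ S₂) where
  flowPT p u := match p with
    | Sum.inl p₁ => ∃ t₁, u.1.1 = some t₁ ∧ S₁.flowPT p₁ t₁
    | Sum.inr p₂ => ∃ t₂, u.1.2 = some t₂ ∧ S₂.flowPT p₂ t₂
  flowTP u p := match p with
    | Sum.inl p₁ => ∃ t₁, u.1.1 = some t₁ ∧ S₁.flowTP t₁ p₁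
    | Sum.inr p₂ => ∃ t₂, u.1.2 = some t₂ ∧ S₂.flowTP t₂ p₂
  label u := match u.1 with
    | (some t₁, _) => S₁.label t₁
    | (none, t₂) => t₂.bind S₂.label
  init := Sum.elim S₁.init S₂.init
  final := Sum.elim S₁.final S₂.final

/-- The sequence of transitions of the second net in a firing sequence of the product net. -/
def secondRun (S₁ : SystemNet A P₁ T₁) (S₂ : SystemNet A P₂ T₂)
    (s : List (productTransitions S₁ S₂)) : List T₂ :=
  s.filterMap fun u => u.1.2

/-- The move represented by a transition of the product net, the first net being the model and the
second one the log: `(t₁, ≫)` is a move on model, `(≫, t₂)` is a move on log, and `(t₁, t₂)` is a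
synchronous move. An invisible transition of the log net represents no move. -/
def moveOf (S₁ : SystemNet A P₁ T₁) (S₂ : SystemNet A P₂ T₂) (u : productTransitions S₁ S₂) :
    Option (Move A T₁) :=
  match u.1 with
  | (some t₁, none) => some (none, some (S₁.label t₁, t₁))
  | (none, some t₂) => (S₂.label t₂).map fun a => (some a, none)
  | (some t₁, some t₂) => some (S₂.label t₂, some (S₁.label t₁, t₁))
  | (none, none) => none

/-- The sequence of moves represented by a firing sequence of the product net. -/
def productMoves (S₁ : SystemNet A P₁ T₁) (S₂ : SystemNet A P₂ T₂)
    (s : List (productTransitions S₁ S₂)) : List (Move A T₁) :=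
  s.filterMap (moveOf S₁ S₂)

/-- `s` is a result of the search for an optimal alignment on the product net: a complete firing
sequence that yields the lowest cost. -/
def IsOptimalProductFiring (S₁ : SystemNet A P₁ T₁) (S₂ : SystemNet A P₂ T₂)
    (δ : Move A T₁ → ℕ) (s : List (productTransitions S₁ S₂)) : Prop :=
  s ∈ (productNet S₁ S₂).completeFirings ∧
  ∀ s' ∈ (productNet S₁ S₂).completeFirings,
    cost δ (productMoves S₁ S₂ s) ≤ cost δ (productMoves S₁ S₂ s')

end Product

/-! ## Uncertain traces and their realizations -/

/-- The symbols `!` (the event certainly occurred) and `?` (it possibly did not occur). -/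
inductive Qualifier
  | determinate
  | indeterminate

/-- A simple uncertain event, with identifiers in `I`, activities in `A`, timestamps in `Θ`. -/
structure UncertainEvent (I A Θ : Type*) [LinearOrder Θ] where
  id : I
  acts : Set A
  acts_nonempty : acts.Nonempty
  tmin : Θ
  tmax : Θ
  tmin_le_tmax : tmin ≤ tmax
  qual : Qualifier

/-- The strict partial order on uncertain events: `e` certainly happens before `e'`. -/
def UncertainEvent.Before {I A Θ : Type*} [LinearOrder Θ] (e e' : UncertainEvent I A Θ) : Prop :=
  e.tmax < e'.tmin

/-- A simple uncertain trace: a finite set of uncertain events with unique identifiers. -/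
structure UncertainTrace (I A Θ : Type*) [LinearOrder Θ] where
  events : Finset (UncertainEvent I A Θ)
  id_unique : ∀ e ∈ events, ∀ e' ∈ events, e.id = e'.id → e = e'

namespace UncertainTrace

variable {I A Θ : Type*} [LinearOrder Θ]

/-- The order-realizations: permutations of the events in which no event comes after an event that
it certainly precedes. -/
def orderRealizations (σU : UncertainTrace I A Θ) : Set (List (UncertainEvent I A Θ)) :=
  {l | l.Nodup ∧ (∀ e, e ∈ l ↔ e ∈ σU.events) ∧ l.Pairwise fun e e' => ¬ e'.Before e}

/-- The realizations of an order-realization `l`: choose a subsequence `f` of `l` that contains all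
determinate events, and one possible activity for each event of `f`. -/
def realizationsOf (l : List (UncertainEvent I A Θ)) : Set (List A) :=
  {σ | ∃ f : List (UncertainEvent I A Θ), List.Forall₂ (fun a e => a ∈ e.acts) σ f ∧
    f.Sublist l ∧ ∀ e ∈ l, e.qual = Qualifier.determinate → e ∈ f}

/-- The realizations of an uncertain trace. -/
def realizations (σU : UncertainTrace I A Θ) : Set (List A) :=
  ⋃ l ∈ σU.orderRealizations, realizationsOf l

end UncertainTrace

/-! ## Behavior graphs and behavior nets -/

/-- `p` is a path of `G` from `v` to `w`. -/
def IsPath {V : Type*} (G : Digraph V) (v w : V) (p : List V) : Prop :=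
  p.IsChain G.Adj ∧ p.head? = some v ∧ p.getLast? = some w

/-- The transitive reduction of a finite acyclic directed graph: it keeps exactly those edges
`(v, w)` for which `⟨v, w⟩` is the only path from `v` to `w`. -/
def transitiveReduction {V : Type*} (G : Digraph V) : Digraph V where
  Adj v w := G.Adj v w ∧ ∀ p, IsPath G v w p → p = [v, w]

/-- The nodes `start` and `finish`, and the vertices of the behavior graph. -/
inductive BNode (V : Type*)
  | start
  | vertex (v : V)
  | finish

namespace UncertainTrace

variable {I A Θ : Type*} [LinearOrder Θ]

/-- The vertices of the behavior graph: the events of the trace. -/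
abbrev Vertex (σU : UncertainTrace I A Θ) := {e : UncertainEvent I A Θ // e ∈ σU.events}

/-- The graph of the precedence relation on the events of the trace. -/
def precedenceGraph (σU : UncertainTrace I A Θ) : Digraph σU.Vertex where
  Adj v w := v.1.Before w.1

/-- The behavior graph. -/
def behaviorGraph (σU : UncertainTrace I A Θ) : Digraph σU.Vertex :=
  transitiveReduction σU.precedenceGraph

/-- The places of the behavior net: the edges `(v, w)` of the behavior graph, a place `(start, v)`
for each vertex without predecessor, a place `(v, finish)` for each vertex without successor. -/
def behaviorPlaces (σU : UncertainTrace I A Θ) : Set (BNode σU.Vertex × BNode σU.Vertex) :=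
  {p | ∃ v w, σU.behaviorGraph.Adj v w ∧ p = (BNode.vertex v, BNode.vertex w)} ∪
  {p | ∃ v, (¬ ∃ v', σU.behaviorGraph.Adj v' v) ∧ p = (BNode.start, BNode.vertex v)} ∪
  {p | ∃ v, (¬ ∃ v', σU.behaviorGraph.Adj v v') ∧ p = (BNode.vertex v, BNode.finish)}

/-- The transitions of the behavior net: `(v, a)` for each possible activity `a` of `v`, and
`(v, τ)` for each indeterminate event `v`. -/
def behaviorTransitions (σU : UncertainTrace I A Θ) : Set (σU.Vertex × Option A) :=
  {t | ∃ v a, a ∈ v.1.acts ∧ t = (v, some a)} ∪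
  {t | ∃ v, v.1.qual = Qualifier.indeterminate ∧ t = (v, none)}

/-- The behavior net: the input places of a transition `(v, a)` are the places `(x, v)`, and its
output places are the places `(v, y)`. Initially there is one token in each place `(start, v)`,
finally there is one token in each place `(v, finish)`. -/
noncomputable def behaviorNet (σU : UncertainTrace I A Θ) :
    SystemNet A σU.behaviorPlaces σU.behaviorTransitions where
  flowPT p t := p.1.2 = BNode.vertex t.1.1
  flowTP t p := p.1.1 = BNode.vertex t.1.1
  label t := t.1.2
  init := Set.indicator {p | p.1.1 = BNode.start} 1
  final := Set.indicator {p | p.1.2 = BNode.finish} 1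

/-- The costs of the optimal alignments of the realizations of an uncertain trace. -/
def realizationCosts {T : Type*} (σU : UncertainTrace I A Θ) (δ : Move A T → ℕ)
    (lam : List A → List (Move A T)) : Set ℕ :=
  {c | ∃ σ ∈ σU.realizations, c = cost δ (lam σ)}

/-- The lower bound for the alignment cost of an uncertain trace. -/
noncomputable def deltaMin {T : Type*} (σU : UncertainTrace I A Θ) (δ : Move A T → ℕ)
    (lam : List A → List (Move A T)) : ℕ :=
  sInf (σU.realizationCosts δ lam)

end UncertainTrace

/-!
The product net has the places of both nets side by side, so a sequence of its transitions fires
exactly when its two projections fire in the two components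
(`SystemNet.firesSeq_productNet_iff`). Hence the moves represented by a complete firing sequence
form an alignment of the label sequence of its second projection
(`productMoves_mem_alignments`), and conversely every alignment of a trace of the second net is
represented by some complete firing sequence (`exists_completeFiring_productMoves_eq`). Minimising
the cost over complete firing sequences of the product is therefore the same as minimising it
over all alignments of all traces of the behavior net.

It remains to see that the traces of the behavior net are the realizations
(`UncertainTrace.visibleTraces_behaviorNet`). A place `(x, y)` always holds
`[x = start] + #x - #y` tokens, where `#v` is the number of firings belonging to `v`. Reading this
in the final marking shows, by induction along the precedence order, that every event fires exactly
once. Since the count is nonnegative after every prefix, `#y ≤ #x` there for every edge `(x, y)`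
of the behavior graph, and hence, as the transitive reduction of a finite strict order generates
that order, for every pair `x ≺ y`. So the events fire in an order-realization. Conversely, along
an order-realization the place `(x, y)` is marked precisely while `x` has fired and `y` has not,
which enables every transition in its turn.
-/

/-! ### Firing sequences -/

namespace SystemNet

variable {A P T : Type*}

/-- The marking obtained from `M` by firing `t`; meaningful if `t` is enabled in `M`. -/
noncomputable def fire (N : SystemNet A P T) (M : Marking P) (t : T) : Marking P :=
  (M - (N.pre t).indicator 1) + (N.post t).indicator 1

theorem firesSeq_nil_iff {N : SystemNet A P T} {M M' : Marking P} :
    N.FiresSeq M [] M' ↔ M = M' := by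
  constructor
  · rintro ⟨⟩
    rfl
  · rintro rfl
    exact .nil M

theorem firesSeq_cons_iff {N : SystemNet A P T} {M M' : Marking P} {t : T} {s : List T} :
    N.FiresSeq M (t :: s) M' ↔ N.Enabled M t ∧ N.FiresSeq (N.fire M t) s M' := by
  constructor
  · rintro (_ | ⟨⟨he, rfl⟩, hs⟩)
    exact ⟨he, hs⟩
  · rintro ⟨he, hs⟩
    exact .cons ⟨he, rfl⟩ hs

theorem FiresSeq.exists_of_append {N : SystemNet A P T} {s₁ s₂ : List T} :
    ∀ {M M' : Marking P}, N.FiresSeq M (s₁ ++ s₂) M' →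
      ∃ M₁, N.FiresSeq M s₁ M₁ ∧ N.FiresSeq M₁ s₂ M' := by
  induction s₁ with
  | nil => exact fun h => ⟨_, .nil _, h⟩
  | cons t s₁ ih =>
    intro M M' h
    obtain ⟨he, hs⟩ := firesSeq_cons_iff.1 h
    obtain ⟨M₁, h₁, h₂⟩ := ih hs
    exact ⟨M₁, firesSeq_cons_iff.2 ⟨he, h₁⟩, h₂⟩

open Classical in
/-- Token conservation: the tokens in a place, plus those consumed, are the initial ones plus those
produced. -/
theorem FiresSeq.marking_add_countP {N : SystemNet A P T} {s : List T} (p : P) :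
    ∀ {M M' : Marking P}, N.FiresSeq M s M' →
      M' p + s.countP (fun t => N.flowPT p t) = M p + s.countP (fun t => N.flowTP t p) := by
  induction s with
  | nil =>
    intro M M' h
    rw [firesSeq_nil_iff.1 h]
    rfl
  | cons t s ih =>
    intro M M' h
    obtain ⟨he, hs⟩ := firesSeq_cons_iff.1 h
    have h₁ := ih hs
    have h₂ : N.flowPT p t → 1 ≤ M p := he p
    simp only [fire, pre, post, Pi.add_apply, Pi.sub_apply, Set.indicator_apply,
      Set.mem_ofPred_eq, Pi.one_apply] at h₁
    simp only [List.countP_cons, decide_eq_true_eq]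
    split_ifs at h₁ ⊢ <;> grind

end SystemNet

/-! ### Firing sequences of the product net -/

section Product

variable {A P₁ T₁ P₂ T₂ : Type*} {S₁ : SystemNet A P₁ T₁} {S₂ : SystemNet A P₂ T₂}

/-- The sequence of transitions of the first net in a firing sequence of the product net. -/
def firstRun (S₁ : SystemNet A P₁ T₁) (S₂ : SystemNet A P₂ T₂)
    (s : List (productTransitions S₁ S₂)) : List T₁ :=
  s.filterMap fun u => u.1.1

namespace SystemNet

theorem enabled_productNet_iff {M₁ : Marking P₁} {M₂ : Marking P₂}
    {u : productTransitions S₁ S₂} :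
    (productNet S₁ S₂).Enabled (Sum.elim M₁ M₂) u ↔
      (∀ t ∈ u.1.1, S₁.Enabled M₁ t) ∧ ∀ t ∈ u.1.2, S₂.Enabled M₂ t := by
  simp only [Enabled, pre, productNet, Set.mem_ofPred_eq, Sum.forall, Sum.elim_inl, Sum.elim_inr,
    Option.mem_def]
  grind

theorem fire_productNet {M₁ : Marking P₁} {M₂ : Marking P₂} {u : productTransitions S₁ S₂} :
    (productNet S₁ S₂).fire (Sum.elim M₁ M₂) u =
      Sum.elim (u.1.1.elim M₁ (S₁.fire M₁)) (u.1.2.elim M₂ (S₂.fire M₂)) := by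
  classical
  obtain ⟨⟨o₁, o₂⟩, hu⟩ := u
  funext p
  rcases p with p | p
  · cases o₁ <;> simp [fire, pre, post, productNet, Set.indicator_apply]
  · cases o₂ <;> simp [fire, pre, post, productNet, Set.indicator_apply]

/-- A sequence fires in the product net if and only if its projections fire in the components. -/
theorem firesSeq_productNet_iff {s : List (productTransitions S₁ S₂)} :
    ∀ {M₁ M₁' : Marking P₁} {M₂ M₂' : Marking P₂},
      (productNet S₁ S₂).FiresSeq (Sum.elim M₁ M₂) s (Sum.elim M₁' M₂') ↔
        S₁.FiresSeq M₁ (firstRun S₁ S₂ s) M₁' ∧ S₂.FiresSeq M₂ (secondRun S₁ S₂ s) M₂' := by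
  induction s with
  | nil =>
    intro M₁ M₁' M₂ M₂'
    simp only [firstRun, secondRun, List.filterMap_nil, firesSeq_nil_iff]
    refine ⟨fun h => ⟨?_, ?_⟩, by rintro ⟨rfl, rfl⟩; rfl⟩
    · exact funext fun p => congrFun h (.inl p)
    · exact funext fun p => congrFun h (.inr p)
  | cons u s ih =>
    intro M₁ M₁' M₂ M₂'
    rw [firesSeq_cons_iff, enabled_productNet_iff, fire_productNet, ih]
    obtain ⟨⟨o₁, o₂⟩, hu⟩ := u
    cases o₁ <;> cases o₂ <;>
      simp [firstRun, secondRun, firesSeq_cons_iff] <;> tauto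

end SystemNet

theorem mem_completeFirings_productNet_iff {s : List (productTransitions S₁ S₂)} :
    s ∈ (productNet S₁ S₂).completeFirings ↔
      firstRun S₁ S₂ s ∈ S₁.completeFirings ∧ secondRun S₁ S₂ s ∈ S₂.completeFirings :=
  SystemNet.firesSeq_productNet_iff

/-! ### Alignments as firing sequences of the product net -/

theorem logRow_productMoves (s : List (productTransitions S₁ S₂)) :
    logRow (productMoves S₁ S₂ s) = S₂.labels (secondRun S₁ S₂ s) := by
  simp only [logRow, productMoves, SystemNet.labels, secondRun, List.filterMap_filterMap]
  congr 1
  funext ⟨⟨o₁, o₂⟩, hu⟩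
  rcases o₁ with _ | t₁ <;> rcases o₂ with _ | t₂ <;> simp [moveOf]
  cases S₂.label t₂ <;> rfl

theorem modelRow_productMoves (s : List (productTransitions S₁ S₂)) :
    modelRow (productMoves S₁ S₂ s) = firstRun S₁ S₂ s := by
  simp only [modelRow, productMoves, firstRun, List.filterMap_filterMap]
  congr 1
  funext ⟨⟨o₁, o₂⟩, hu⟩
  rcases o₁ with _ | t₁ <;> rcases o₂ with _ | t₂ <;> simp [moveOf]

theorem moveOf_mem_legalMoves {u : productTransitions S₁ S₂} {m : Move A T₁}
    (h : moveOf S₁ S₂ u = some m) : m ∈ LegalMoves S₁ := by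
  obtain ⟨u, (⟨t₁, rfl⟩ | ⟨t₂, rfl⟩) | ⟨t₁, t₂, rfl, heq, hne⟩⟩ := u
  · exact .inl (.inr ⟨t₁, (Option.some.inj h).symm⟩)
  · obtain ⟨a, -, rfl⟩ := Option.map_eq_some_iff.1 h
    exact .inr ⟨a, rfl⟩
  · obtain ⟨x, hx⟩ := Option.ne_none_iff_exists'.1 hne
    refine .inl (.inl ⟨x, t₁, hx, ?_⟩)
    rw [← Option.some.inj h, ← heq, hx]

theorem productMoves_mem_alignments {s : List (productTransitions S₁ S₂)}
    (hs : s ∈ (productNet S₁ S₂).completeFirings) :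
    productMoves S₁ S₂ s ∈ alignments S₁ (S₂.labels (secondRun S₁ S₂ s)) := by
  refine ⟨_, (mem_completeFirings_productNet_iff.1 hs).1, fun m hm => ?_, logRow_productMoves s,
    modelRow_productMoves s⟩
  obtain ⟨u, -, hu⟩ := List.mem_filterMap.1 hm
  exact moveOf_mem_legalMoves hu

/-- The transition of the product net in which only the second net moves. -/
def secondOnly (S₁ : SystemNet A P₁ T₁) (S₂ : SystemNet A P₂ T₂) (t : T₂) :
    productTransitions S₁ S₂ :=
  ⟨(none, some t), .inl (.inr ⟨t, rfl⟩)⟩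

theorem firstRun_map_secondOnly (r : List T₂) :
    firstRun S₁ S₂ (r.map (secondOnly S₁ S₂)) = [] := by
  simp [firstRun, secondOnly]

theorem secondRun_map_secondOnly (r : List T₂) :
    secondRun S₁ S₂ (r.map (secondOnly S₁ S₂)) = r := by
  simp [secondRun, secondOnly, List.filterMap_map, Function.comp_def]

theorem productMoves_map_secondOnly {r : List T₂} (hr : ∀ t ∈ r, S₂.label t = none) :
    productMoves S₁ S₂ (r.map (secondOnly S₁ S₂)) = [] := by
  simpa [productMoves, secondOnly, moveOf, List.filterMap_eq_nil_iff] using hr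

/-- A sequence of legal moves and a run of the second net that agree on the log row can be merged
into a sequence of transitions of the product net: the invisible transitions of the run are
interleaved in front of the moves that they precede. -/
theorem exists_productMoves_eq {γ : List (Move A T₁)} (hγ : ∀ m ∈ γ, m ∈ LegalMoves S₁) :
    ∀ {r : List T₂}, S₂.labels r = logRow γ → ∃ s : List (productTransitions S₁ S₂),
      productMoves S₁ S₂ s = γ ∧ firstRun S₁ S₂ s = modelRow γ ∧ secondRun S₁ S₂ s = r := by
  induction γ with
  | nil =>
    intro r hr
    refine ⟨r.map (secondOnly S₁ S₂), productMoves_map_secondOnly ?_, firstRun_map_secondOnly r,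
      secondRun_map_secondOnly r⟩
    exact List.filterMap_eq_nil_iff.1 hr
  | cons m γ ih =>
    have ih := @ih fun m' hm' => hγ m' (List.mem_cons_of_mem _ hm')
    have hm := hγ m List.mem_cons_self
    -- The moves that involve the log use up one visible transition of the run.
    have visible : ∀ x, m.1 = some x → (∀ t, S₂.label t = some x →
        ∃ u : productTransitions S₁ S₂, moveOf S₁ S₂ u = some m ∧ u.1.1 = m.2.map Prod.snd ∧
          u.1.2 = some t) →
        ∀ r : List T₂, S₂.labels r = logRow (m :: γ) → ∃ s : List (productTransitions S₁ S₂),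
          productMoves S₁ S₂ s = m :: γ ∧ firstRun S₁ S₂ s = modelRow (m :: γ) ∧
            secondRun S₁ S₂ s = r := by
      intro x hx hu r hr
      have hr' : r.filterMap S₂.label = x :: logRow γ :=
        hr.trans (List.filterMap_cons_some hx)
      obtain ⟨r₁, t, r₂, rfl, hr₁, ht, hr₂⟩ := List.filterMap_eq_cons_iff.1 hr'
      obtain ⟨u, hum, hu₁, hu₂⟩ := hu t ht
      obtain ⟨s, hs, hs₁, hs₂⟩ := ih hr₂
      refine ⟨r₁.map (secondOnly S₁ S₂) ++ u :: s, ?_, ?_, ?_⟩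
      · have h := productMoves_map_secondOnly (S₁ := S₁) hr₁
        simp only [productMoves] at h hs ⊢
        rw [List.filterMap_append, h, List.filterMap_cons_some hum, hs, List.nil_append]
      · have h := firstRun_map_secondOnly (S₁ := S₁) (S₂ := S₂) r₁
        simp only [firstRun, modelRow] at h hs₁ ⊢
        rw [List.filterMap_append, h, List.filterMap_cons, List.filterMap_cons, hu₁, hs₁,
          List.nil_append]
      · have h := secondRun_map_secondOnly (S₁ := S₁) (S₂ := S₂) r₁
        simp only [secondRun] at h hs₂ ⊢
        rw [List.filterMap_append, h, List.filterMap_cons, hu₂, hs₂]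
    rcases hm with (⟨x, t₁, hx, rfl⟩ | ⟨t₁, rfl⟩) | ⟨x, rfl⟩
    · refine @(visible x rfl fun t ht =>
        ⟨⟨(some t₁, some t), .inr ⟨t₁, t, rfl, ?_, ?_⟩⟩, ?_, rfl, rfl⟩)
      · rw [hx, ht]
      · simp [hx]
      · simp [moveOf, hx, ht]
    · intro r hr
      obtain ⟨s, hs, hs₁, hs₂⟩ := ih hr
      refine ⟨⟨(some t₁, none), .inl (.inl ⟨t₁, rfl⟩)⟩ :: s, ?_, ?_, ?_⟩
      · simpa [productMoves, moveOf] using hs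
      · simpa [firstRun, modelRow] using hs₁
      · simpa [secondRun] using hs₂
    · refine @(visible x rfl fun t ht => ⟨secondOnly S₁ S₂ t, ?_, rfl, rfl⟩)
      simp [moveOf, secondOnly, ht]

theorem exists_completeFiring_productMoves_eq {σ : List A} (hσ : σ ∈ S₂.visibleTraces)
    {γ : List (Move A T₁)} (hγ : γ ∈ alignments S₁ σ) :
    ∃ s ∈ (productNet S₁ S₂).completeFirings, productMoves S₁ S₂ s = γ := by
  obtain ⟨r, hr, rfl⟩ := hσ
  obtain ⟨s₁, hs₁, hlegal, hlog, rfl⟩ := hγ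
  obtain ⟨s, hs, hfirst, hsecond⟩ := exists_productMoves_eq hlegal hlog.symm
  refine ⟨s, mem_completeFirings_productNet_iff.2 ⟨?_, ?_⟩, hs⟩
  · rwa [hfirst]
  · rwa [hsecond]

end Product

/-! ### The transitive reduction of the precedence relation -/

namespace UncertainTrace

variable {I A Θ : Type*} [LinearOrder Θ] {σU : UncertainTrace I A Θ}

theorem _root_.UncertainEvent.Before.trans {e₁ e₂ e₃ : UncertainEvent I A Θ}
    (h₁ : e₁.Before e₂) (h₂ : e₂.Before e₃) : e₁.Before e₃ :=
  lt_trans h₁ (lt_of_le_of_lt e₂.tmin_le_tmax h₂)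

theorem _root_.UncertainEvent.Before.irrefl (e : UncertainEvent I A Θ) : ¬ e.Before e :=
  not_lt_of_ge e.tmin_le_tmax

instance : IsStrictOrder σU.Vertex (fun v w => v.1.Before w.1) where
  irrefl v := UncertainEvent.Before.irrefl v.1
  trans _ _ _ := UncertainEvent.Before.trans

theorem before_of_adj {v w : σU.Vertex} (h : σU.behaviorGraph.Adj v w) : v.1.Before w.1 := h.1

/-- A precedence without intermediate event is an edge of the behavior graph: a path with more
than one edge would have its second vertex strictly in between. -/
theorem behaviorGraph_adj_of_no_between {v w : σU.Vertex} (h : v.1.Before w.1)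
    (hno : ∀ x : σU.Vertex, v.1.Before x.1 → ¬ x.1.Before w.1) : σU.behaviorGraph.Adj v w := by
  refine ⟨h, fun p ⟨hchain, hhead, hlast⟩ => ?_⟩
  have hp : p.Pairwise fun a b => a.1.Before b.1 := List.isChain_iff_pairwise.1 hchain
  rcases p with _ | ⟨a, _ | ⟨b, p⟩⟩
  · simp at hhead
  · obtain rfl : a = v := by simpa using hhead
    obtain rfl : a = w := by simpa using hlast
    exact absurd h (UncertainEvent.Before.irrefl _)
  · obtain rfl : a = v := by simpa using hhead
    rcases p.eq_nil_or_concat with rfl | ⟨q, c, rfl⟩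
    · obtain rfl : b = w := by simpa using hlast
      rfl
    · have hcw : c = w := by simpa [List.getLast?_cons] using hlast
      subst hcw
      have hab : a.1.Before b.1 := (List.pairwise_cons.1 hp).1 b (by simp)
      have hbc : b.1.Before c.1 :=
        (List.pairwise_cons.1 (List.pairwise_cons.1 hp).2).1 c (by simp)
      exact absurd hbc (hno b hab)

/-- A relation that is reflexive, transitive and holds along the edges of the behavior graph holds
along the whole precedence relation: the transitive reduction generates it. -/
theorem rel_of_before {r : σU.Vertex → σU.Vertex → Prop}
    (htrans : ∀ {a b c}, r a b → r b c → r a c)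
    (hadj : ∀ v w, σU.behaviorGraph.Adj v w → r v w) {v w : σU.Vertex}
    (h : v.1.Before w.1) : r v w := by
  have hwf : WellFounded fun a b : σU.Vertex => a.1.Before b.1 :=
    Finite.wellFounded_of_trans_of_irrefl _
  have hwf' : WellFounded fun a b : σU.Vertex => b.1.Before a.1 :=
    @Finite.wellFounded_of_trans_of_irrefl _ _ (fun a b : σU.Vertex => b.1.Before a.1)
      ⟨fun _ _ _ h₁ h₂ => UncertainEvent.Before.trans h₂ h₁⟩
      ⟨fun a => UncertainEvent.Before.irrefl a.1⟩
  -- Induct on the upper end; below a fixed upper end, induct downwards on the lower end.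
  induction w using hwf.induction generalizing v with
  | _ w ihw =>
    induction v using hwf'.induction with
    | _ v ihv =>
      by_cases hno : ∀ x : σU.Vertex, v.1.Before x.1 → ¬ x.1.Before w.1
      · exact hadj v w (behaviorGraph_adj_of_no_between h hno)
      · push Not at hno
        obtain ⟨x, hvx, hxw⟩ := hno
        exact htrans (ihw x hxw hvx) (ihv x hvx hxw)

/-! ### Runs of the behavior net -/

/-- The event to which a transition of the behavior net belongs. -/
def eventOf (t : σU.behaviorTransitions) : UncertainEvent I A Θ := t.1.1.1

open Classical in
theorem count_map_vertex (r : List σU.behaviorTransitions) (v : σU.Vertex) :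
    (r.map fun t => t.1.1).count v = r.countP fun t => decide (v = t.1.1) := by
  rw [List.count, List.countP_map]
  refine List.countP_congr fun t _ => ?_
  simp only [Function.comp_apply, beq_iff_eq, decide_eq_true_eq]
  exact eq_comm

open Classical in
/-- The token count of an edge place `(v, w)` after a firing sequence. -/
theorem marking_edge {r : List σU.behaviorTransitions} {M : Marking σU.behaviorPlaces}
    (h : σU.behaviorNet.FiresSeq σU.behaviorNet.init r M) {v w : σU.Vertex}
    (hvw : σU.behaviorGraph.Adj v w) :
    M ⟨(.vertex v, .vertex w), .inl (.inl ⟨v, w, hvw, rfl⟩)⟩ + (r.map fun t => t.1.1).count w =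
      (r.map fun t => t.1.1).count v := by
  have := h.marking_add_countP ⟨(.vertex v, .vertex w), .inl (.inl ⟨v, w, hvw, rfl⟩)⟩
  rw [count_map_vertex, count_map_vertex]
  simpa [behaviorNet] using this

open Classical in
/-- The token count of an initial place after a firing sequence. -/
theorem marking_start {r : List σU.behaviorTransitions} {M : Marking σU.behaviorPlaces}
    (h : σU.behaviorNet.FiresSeq σU.behaviorNet.init r M) {v : σU.Vertex}
    (hv : ¬ ∃ v', σU.behaviorGraph.Adj v' v) :
    M ⟨(.start, .vertex v), .inl (.inr ⟨v, hv, rfl⟩)⟩ + (r.map fun t => t.1.1).count v = 1 := by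
  have := h.marking_add_countP ⟨(.start, .vertex v), .inl (.inr ⟨v, hv, rfl⟩)⟩
  rw [count_map_vertex]
  simpa [behaviorNet] using this

open Classical in
/-- In a complete run every event fires exactly once: all initial places are emptied, and all edge
places are empty at the end, so the count passes from predecessors to successors. -/
theorem count_eq_one {r : List σU.behaviorTransitions} (h : r ∈ σU.behaviorNet.completeFirings)
    (v : σU.Vertex) : (r.map fun t => t.1.1).count v = 1 := by
  have hwf : WellFounded fun a b : σU.Vertex => a.1.Before b.1 :=
    Finite.wellFounded_of_trans_of_irrefl _
  induction v using hwf.induction with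
  | _ v ih =>
    by_cases hv : ∃ v', σU.behaviorGraph.Adj v' v
    · obtain ⟨v', hv'⟩ := hv
      have h₁ := marking_edge h hv'
      rw [ih v' (before_of_adj hv')] at h₁
      simpa [behaviorNet] using h₁
    · simpa [behaviorNet] using marking_start h hv

open Classical in
/-- An event has never fired more often than an event that certainly precedes it, since the edge
places in between never hold a negative number of tokens. -/
theorem count_le_count_of_before {r : List σU.behaviorTransitions}
    {M : Marking σU.behaviorPlaces} (h : σU.behaviorNet.FiresSeq σU.behaviorNet.init r M)
    {v w : σU.Vertex} (hvw : v.1.Before w.1) :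
    (r.map fun t => t.1.1).count w ≤ (r.map fun t => t.1.1).count v := by
  refine rel_of_before (r := fun a b => (r.map fun t => t.1.1).count b ≤
    (r.map fun t => t.1.1).count a) (fun h₁ h₂ => h₂.trans h₁) (fun a b hab => ?_) hvw
  have := marking_edge h hab
  omega

/-- The events of a complete run of the behavior net form an order-realization. -/
theorem map_eventOf_mem_orderRealizations {r : List σU.behaviorTransitions}
    (h : r ∈ σU.behaviorNet.completeFirings) : r.map eventOf ∈ σU.orderRealizations := by
  classical
  have hmap : r.map eventOf = (r.map fun t => t.1.1).map Subtype.val := by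
    simp [eventOf, Function.comp_def]
  have hnodup : (r.map fun t => t.1.1).Nodup :=
    List.nodup_iff_count_le_one.2 fun v => (count_eq_one h v).le
  refine ⟨?_, fun e => ⟨?_, fun he => ?_⟩, ?_⟩
  · rw [hmap]
    exact hnodup.map Subtype.val_injective
  · rw [hmap]
    intro he
    obtain ⟨v, -, rfl⟩ := List.mem_map.1 he
    exact v.2
  · rw [hmap]
    have : 0 < (r.map fun t => t.1.1).count ⟨e, he⟩ := by simp [count_eq_one h]
    exact List.mem_map.2 ⟨_, List.count_pos_iff.1 this, rfl⟩
  · rw [List.pairwise_map, List.pairwise_iff_forall_sublist]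
    intro t t' hsub hbefore
    -- The prefix that ends with `t` contains `t.1.1`, but not the later firing of `t'.1.1`.
    obtain ⟨r₁, r₂, rfl, hr₁, hr₂⟩ := List.cons_sublist_iff.1 hsub
    obtain ⟨M, hM, -⟩ := SystemNet.FiresSeq.exists_of_append h
    have h₁ := count_le_count_of_before hM hbefore
    have h₂ : 0 < (r₁.map fun t => t.1.1).count t.1.1 :=
      List.count_pos_iff.2 (List.mem_map_of_mem hr₁)
    have h₃ : 0 < (r₂.map fun t => t.1.1).count t'.1.1 :=
      List.count_pos_iff.2 (List.mem_map_of_mem (List.singleton_sublist.1 hr₂))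
    have h₄ := count_eq_one h t'.1.1
    rw [List.map_append, List.count_append] at h₄
    omega

theorem labels_mem_realizationsOf (r : List σU.behaviorTransitions) :
    σU.behaviorNet.labels r ∈ realizationsOf (r.map eventOf) := by
  refine ⟨(r.filter fun t => t.1.2.isSome).map eventOf, ?_, List.filter_sublist.map _, ?_⟩
  · induction r with
    | nil => exact .nil
    | cons t r ih =>
      obtain ⟨t, ⟨v, a, ha, rfl⟩ | ⟨v, hv, rfl⟩⟩ := t
      · exact .cons ha ih
      · exact ih
  · intro e he hdet
    obtain ⟨t, ht, rfl⟩ := List.mem_map.1 he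
    refine List.mem_map.2 ⟨t, List.mem_filter.2 ⟨ht, ?_⟩, rfl⟩
    obtain ⟨t, ⟨v, a, ha, rfl⟩ | ⟨v, hv, rfl⟩⟩ := t
    · rfl
    · exact absurd (hv.symm.trans hdet) (by simp)

/-! ### Realizations as traces of the behavior net -/

open Classical in
/-- The marking of the behavior net after the events of `l` have fired: a place `(x, y)` is marked
if `x` is `start` or has fired, and `y` has not fired. -/
noncomputable def markingAfter (l : List σU.Vertex) : Marking σU.behaviorPlaces := fun p =>
  if (p.1.1 = .start ∨ ∃ v ∈ l, p.1.1 = .vertex v) ∧ ¬ ∃ v ∈ l, p.1.2 = .vertex v then 1 else 0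

theorem markingAfter_nil : markingAfter [] = σU.behaviorNet.init := by
  classical
  funext p
  simp [markingAfter, behaviorNet, Set.indicator_apply]

theorem markingAfter_of_forall_mem {l : List σU.Vertex} (hl : ∀ v, v ∈ l) :
    markingAfter l = σU.behaviorNet.final := by
  classical
  funext ⟨p, hp⟩
  rcases hp with (⟨v, w, h, rfl⟩ | ⟨v, h, rfl⟩) | ⟨v, h, rfl⟩ <;>
    simp [markingAfter, behaviorNet, hl]

/-- Once the events of `l` have fired, any run through the remaining events reaches the final
marking, provided that `l` and the run together form an order-realization. -/
theorem firesSeq_markingAfter {r : List σU.behaviorTransitions} :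
    ∀ {l : List σU.Vertex}, (l ++ r.map fun t => t.1.1).Nodup →
      (∀ v, v ∈ l ++ r.map fun t => t.1.1) →
      (l ++ r.map fun t => t.1.1).Pairwise (fun v w => ¬ w.1.Before v.1) →
      σU.behaviorNet.FiresSeq (markingAfter l) r σU.behaviorNet.final := by
  classical
  induction r with
  | nil =>
    intro l _ hall _
    refine SystemNet.firesSeq_nil_iff.2 (markingAfter_of_forall_mem ?_)
    simpa using hall
  | cons t r ih =>
    intro l hnodup hall hpair
    have hnot : t.1.1 ∉ l := fun h =>
      (List.nodup_append.1 hnodup).2.2 _ h _ (List.mem_map_of_mem List.mem_cons_self) rfl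
    -- Every predecessor of the next event has fired, and none of its successors has.
    have hpred : ∀ v : σU.Vertex, v.1.Before t.1.1.1 → v ∈ l := by
      intro v hv
      rcases List.mem_append.1 (hall v) with h | h
      · exact h
      · rcases List.mem_cons.1 h with rfl | h
        · exact absurd hv (UncertainEvent.Before.irrefl _)
        · exact absurd hv ((List.pairwise_cons.1 (List.pairwise_append.1 hpair).2.1).1 v h)
    have hsucc : ∀ v : σU.Vertex, t.1.1.1.Before v.1 → v ∉ l := fun v hv h =>
      (List.pairwise_append.1 hpair).2.2 v h _ (List.mem_map_of_mem List.mem_cons_self) hv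
    have hfire : σU.behaviorNet.fire (markingAfter l) t = markingAfter (l ++ [t.1.1]) := by
      funext ⟨p, hp⟩
      rcases hp with (⟨v, w, h, rfl⟩ | ⟨v, h, rfl⟩) | ⟨v, h, rfl⟩
      · have h' := before_of_adj h
        have hne : ¬ (v = t.1.1 ∧ w = t.1.1) := by
          rintro ⟨h₁, h₂⟩
          rw [h₁, h₂] at h'
          exact UncertainEvent.Before.irrefl _ h'
        have hv : w = t.1.1 → v ∈ l := by
          rintro rfl
          exact hpred v h'
        have hw : v = t.1.1 → w ∉ l := by
          rintro rfl
          exact hsucc w h'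
        -- The place is filled if `v` fires, emptied if `w` fires, and otherwise unchanged.
        simp [SystemNet.fire, SystemNet.pre, SystemNet.post, Set.indicator_apply, behaviorNet,
          markingAfter]
        clear ih hnodup hall hpair hpred hsucc
        by_cases h₁ : v = t.1.1 <;> by_cases h₂ : w = t.1.1 <;> simp_all
      · simp [SystemNet.fire, SystemNet.pre, SystemNet.post, Set.indicator_apply, behaviorNet,
          markingAfter]
        clear ih hnodup hall hpair hpred hsucc
        by_cases h₁ : v = t.1.1 <;> simp_all
      · simp [SystemNet.fire, SystemNet.pre, SystemNet.post, Set.indicator_apply, behaviorNet,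
          markingAfter]
        clear ih hnodup hall hpair hpred hsucc
        by_cases h₁ : v = t.1.1 <;> simp_all
    rw [SystemNet.firesSeq_cons_iff, hfire]
    refine ⟨?_, ih ?_ ?_ ?_⟩
    · rintro ⟨p, (⟨v, w, h, rfl⟩ | ⟨v, h, rfl⟩) | ⟨v, h, rfl⟩⟩ hpre
      · obtain rfl : w = t.1.1 := BNode.vertex.inj hpre
        simp [markingAfter, hpred v (before_of_adj h), hnot]
      · obtain rfl : v = t.1.1 := BNode.vertex.inj hpre
        simp [markingAfter, hnot]
      · exact absurd hpre (by simp [behaviorNet, SystemNet.pre])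
    · simpa using hnodup
    · simpa using hall
    · simpa using hpair

theorem mem_completeFirings_of_map_eventOf {r : List σU.behaviorTransitions}
    (h : r.map eventOf ∈ σU.orderRealizations) : r ∈ σU.behaviorNet.completeFirings := by
  have hmap : r.map eventOf = (r.map fun t => t.1.1).map Subtype.val := by
    simp [eventOf, Function.comp_def]
  rw [hmap] at h
  obtain ⟨hnodup, hall, hpair⟩ := h
  have := firesSeq_markingAfter (r := r) (l := []) (List.Nodup.of_map _ hnodup) (fun v => ?_)
    (List.pairwise_map.1 hpair)
  · rwa [markingAfter_nil] at this
  · obtain ⟨w, hw, hwv⟩ := List.mem_map.1 ((hall v.1).2 v.2)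
    rwa [Subtype.val_injective hwv] at hw

/-- A choice of a subsequence and of activities is a choice of one transition per event. -/
theorem exists_map_eventOf_eq {l f : List (UncertainEvent I A Θ)} (hsub : f.Sublist l) :
    ∀ {σ : List A}, (∀ e ∈ l, e ∈ σU.events) → l.Nodup →
      (∀ e ∈ l, e.qual = Qualifier.determinate → e ∈ f) →
      List.Forall₂ (fun a e => a ∈ e.acts) σ f →
      ∃ r : List σU.behaviorTransitions, r.map eventOf = l ∧ σU.behaviorNet.labels r = σ := by
  induction hsub with
  | slnil =>
    rintro σ - - - ⟨⟩
    exact ⟨[], rfl, rfl⟩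
  | @cons f l e hsub ih =>
    intro σ hmem hnodup hdet hσ
    obtain ⟨hel, hnodup⟩ := List.nodup_cons.1 hnodup
    obtain ⟨r, hr, hlab⟩ := ih (fun e' he' => hmem e' (List.mem_cons_of_mem _ he')) hnodup
      (fun e' he' => hdet e' (List.mem_cons_of_mem _ he')) hσ
    have hind : e.qual = Qualifier.indeterminate := by
      cases hq : e.qual with
      | indeterminate => rfl
      | determinate => exact absurd (hsub.subset (hdet e List.mem_cons_self hq)) hel
    refine ⟨⟨(⟨e, hmem e List.mem_cons_self⟩, none), .inr ⟨_, hind, rfl⟩⟩ :: r, ?_, ?_⟩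
    · rw [List.map_cons, hr]
      rfl
    · exact hlab
  | @cons_cons f l e hsub ih =>
    intro σ hmem hnodup hdet hσ
    obtain ⟨hel, hnodup⟩ := List.nodup_cons.1 hnodup
    rcases hσ with _ | ⟨ha, hσ⟩
    rename_i a σ
    obtain ⟨r, hr, hlab⟩ := ih (fun e' he' => hmem e' (List.mem_cons_of_mem _ he')) hnodup
      (fun e' he' hq => (List.mem_cons.1 (hdet e' (List.mem_cons_of_mem _ he') hq)).resolve_left
        fun h => hel (h ▸ he')) hσ
    refine ⟨⟨(⟨e, hmem e List.mem_cons_self⟩, some a), .inl ⟨_, a, ha, rfl⟩⟩ :: r, ?_, ?_⟩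
    · rw [List.map_cons, hr]
      rfl
    · rw [← hlab]
      rfl

/-- The traces of the behavior net are the realizations of the uncertain trace. -/
theorem visibleTraces_behaviorNet (σU : UncertainTrace I A Θ) :
    σU.behaviorNet.visibleTraces = σU.realizations := by
  ext σ
  simp only [realizations, Set.mem_iUnion, exists_prop]
  constructor
  · rintro ⟨r, hr, rfl⟩
    exact ⟨_, map_eventOf_mem_orderRealizations hr, labels_mem_realizationsOf r⟩
  · rintro ⟨l, hl, f, hσ, hsub, hdet⟩
    obtain ⟨r, rfl, hlab⟩ := exists_map_eventOf_eq (σU := σU) hsub (fun e he => (hl.2.1 e).1 he)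
      hl.1 hdet hσ
    exact ⟨r, mem_completeFirings_of_map_eventOf hl, hlab⟩

/-! ### Existence of realizations -/

/-- Sorting the events by their minimal timestamps gives an order-realization. -/
theorem orderRealizations_nonempty (σU : UncertainTrace I A Θ) :
    σU.orderRealizations.Nonempty := by
  let le : UncertainEvent I A Θ → UncertainEvent I A Θ → Bool := fun e e' => e.tmin ≤ e'.tmin
  refine ⟨σU.events.toList.mergeSort le, ?_, fun e => ?_, ?_⟩
  · exact (List.mergeSort_perm _ _).nodup_iff.2 σU.events.nodup_toList
  · rw [List.mem_mergeSort, Finset.mem_toList]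
  · refine (List.pairwise_mergeSort (le := le) ?_ ?_ _).imp fun {e e'} h hbefore => ?_
    · intro a b c hab hbc
      simp only [le, decide_eq_true_eq] at *
      exact hab.trans hbc
    · intro a b
      simpa [le] using le_total a.tmin b.tmin
    · simp only [le, decide_eq_true_eq] at h
      exact absurd hbefore (not_lt_of_ge (h.trans e'.tmin_le_tmax))

theorem realizations_nonempty (σU : UncertainTrace I A Θ) : σU.realizations.Nonempty := by
  obtain ⟨l, hl⟩ := σU.orderRealizations_nonempty
  refine ⟨l.map fun e => e.acts_nonempty.some, Set.mem_biUnion hl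
    ⟨l, ?_, List.Sublist.refl l, fun e he _ => he⟩⟩
  rw [List.forall₂_map_left_iff]
  exact List.forall₂_same.2 fun e _ => e.acts_nonempty.some_mem

theorem isLeast_deltaMin {T : Type*} (σU : UncertainTrace I A Θ) (δ : Move A T → ℕ)
    (lam : List A → List (Move A T)) :
    IsLeast (σU.realizationCosts δ lam) (σU.deltaMin δ lam) := by
  obtain ⟨σ, hσ⟩ := σU.realizations_nonempty
  exact ⟨Nat.sInf_mem ⟨_, σ, hσ, rfl⟩, fun _ hc => Nat.sInf_le hc⟩

end UncertainTrace

/-! ### Correctness of uncertain alignments -/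

theorem mainTheorem2 {A P T I Θ : Type*} [LinearOrder Θ]
    (SN : SystemNet A P T) (hSN : SN.visibleTraces.Nonempty)
    (δ : Move A T → ℕ)
    (lam : List A → List (Move A T)) (hlam : IsOptimalAlignmentMap SN δ lam)
    (σU : UncertainTrace I A Θ) :
    IsLeast (σU.realizationCosts δ lam) (σU.deltaMin δ lam) ∧
    (∃ s, IsOptimalProductFiring SN σU.behaviorNet δ s) ∧
    ∀ s, IsOptimalProductFiring SN σU.behaviorNet δ s →
      ∃ σbn : List A,
        secondRun SN σU.behaviorNet s ∈ σU.behaviorNet.completeFirings ∧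
        σU.behaviorNet.labels (secondRun SN σU.behaviorNet s) = σbn ∧
        logRow (productMoves SN σU.behaviorNet s) = σbn ∧
        σbn ∈ σU.realizations ∧
        IsOptimalAlignment SN δ σbn (productMoves SN σU.behaviorNet s) ∧
        cost δ (productMoves SN σU.behaviorNet s) = cost δ (lam σbn) ∧
        cost δ (lam σbn) = σU.deltaMin δ lam := by
  have hleast := σU.isLeast_deltaMin δ lam
  obtain ⟨σ, hσ, hmin⟩ := hleast.1
  -- A complete firing sequence that represents the cheapest of the chosen alignments.
  obtain ⟨s₀, hs₀, hmoves⟩ := exists_completeFiring_productMoves_eq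
    (σU.visibleTraces_behaviorNet.symm ▸ hσ) (hlam σ).1
  refine ⟨hleast, ?_, fun s hs => ?_⟩
  · obtain ⟨s, hs, hsmin⟩ := exists_minimalFor_of_wellFoundedLT
      (· ∈ (productNet SN σU.behaviorNet).completeFirings)
      (fun s => cost δ (productMoves SN σU.behaviorNet s)) ⟨s₀, hs₀⟩
    exact ⟨s, hs, fun s' hs' => (le_total _ _).elim id (hsmin hs')⟩
  · have hrun := (mem_completeFirings_productNet_iff.1 hs.1).2
    have halign := productMoves_mem_alignments hs.1
    have hreal : σU.behaviorNet.labels (secondRun SN σU.behaviorNet s) ∈ σU.realizations :=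
      σU.visibleTraces_behaviorNet ▸ ⟨_, hrun, rfl⟩
    have h₁ := hs.2 s₀ hs₀
    rw [hmoves, ← hmin] at h₁
    have h₂ := (hlam _).2 _ halign
    have h₃ := hleast.2 ⟨_, hreal, rfl⟩
    exact ⟨_, hrun, rfl, logRow_productMoves s, hreal,
      ⟨halign, fun γ hγ => (h₁.trans h₃).trans ((hlam _).2 γ hγ)⟩,
      le_antisymm (h₁.trans h₃) h₂, le_antisymm (h₂.trans h₁) h₃⟩
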